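/- Let $n\ge 3$ be odd, $m=\frac{n-1}{2}$, let $\nu>0$ and let $\kappa_1,\dots,\kappa_{n-1}$ be real constants with $\kappa_j>0$ for $1\le j\le n-2$ and $\kappa_{n-1}\neq 0$. Let $I\subseteq\mathbb R$ be an interval with more than one point and let $f:I\to\mathbb R^n$ be a curve of class $C^n$ which is $(n-1)$-regular, that is, $f'(t),\dots,f^{(n-1)}(t)$ are linearly independent for every $t\in I$. The Frenet frame $V_1,\dots,V_n$ of $f$ is defined as follows: $V_1,\dots,V_{n-1}$ is obtained from $f',\dots,f^{(n-1)}$ by Gram–Schmidt orthonormalization, and $V_n=V_1\times\cdots\times V_{n-1}$, where $w_1\times\cdots\times w_{n-1}$ is the vector $c$ with $c\cdot X=\det(w_1,\dots,w_{n-1},X)$ for all $X\in\mathbb R^n$. The speed of $f$ is $\|f'\|$, and its curvatures are the functions $(V_j'\cdot V_{j+1})/\|f'\|$, $1\le j\le n-1$. Suppose that $f$ has constant speed $\nu$ and that, for each $1\le j\le n-1$, its $j$-th curvature is constantly equal to $\kappa_j$. Then $f$ is, up to an isometry, a generalized circular helix: there exist positive real numbers $a_1,\dots,a_m$, pairwise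 distinct, positive real numbers $r_1,\dots,r_m$, a real number $b\neq 0$, and an isometry $F:\mathbb R^n\to\mathbb R^n$ such that $$f(t)=F\bigl(r_1\cos(a_1t),\,r_1\sin(a_1t),\,\dots,\,r_m\cos(a_mt),\,r_m\sin(a_mt),\,b\,t\bigr)\qquad\text{for all }t\in I,$$ that is, identifying $\mathbb R^n$ with $\mathbb C^m\times\mathbb R$, $f(t)=F(r_1e^{\mathbf i a_1t},\dots,r_me^{\mathbf i a_mt},bt)$. -/

import Mathlib

noncomputable section

/-- The cross product `w₁ × ⋯ × wₙ` of `n` vectors of `ℝⁿ⁺¹`: the vector `c` with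
`c ⬝ X = det (w₁, …, wₙ, X)` for every `X`. Its `i`-th coordinate is `det (w₁, …, wₙ, eᵢ)`. -/
def crossProductN {n : ℕ} (w : Fin n → EuclideanSpace ℝ (Fin (n + 1))) :
    EuclideanSpace ℝ (Fin (n + 1)) :=
  WithLp.toLp 2 fun i =>
    Matrix.det (Matrix.of
      (Fin.snoc (α := fun _ => Fin (n + 1) → ℝ) (fun k => (w k).ofLp) (Pi.single i 1)))

/-- The curve `f` is `k`-regular on `I`: the derivatives `f', f'', …, f⁽ᵏ⁾` are linearly
independent at every point of `I`. -/
def IsRegularCurve {d : ℕ} (k : ℕ) (f : ℝ → EuclideanSpace ℝ (Fin d)) (I : Set ℝ) : Prop :=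
  ∀ t ∈ I, LinearIndependent ℝ fun j : Fin k => iteratedDerivWithin (j + 1) f I t

/-- The Frenet frame `V₁, …, Vₙ₊₁` at `t` of an `n`-regular curve `f : I → ℝⁿ⁺¹` (with indices
shifted by one): `V₁, …, Vₙ` come from `f', …, f⁽ⁿ⁾` by the Gram–Schmidt process,
and `Vₙ₊₁ = V₁ × ⋯ × Vₙ`. -/
def frenetFrame {n : ℕ} (f : ℝ → EuclideanSpace ℝ (Fin (n + 1))) (I : Set ℝ) (t : ℝ) :
    Fin (n + 1) → EuclideanSpace ℝ (Fin (n + 1)) :=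
  let V : Fin n → EuclideanSpace ℝ (Fin (n + 1)) :=
    InnerProductSpace.gramSchmidtNormed ℝ fun j : Fin n => iteratedDerivWithin (j + 1) f I t
  Fin.snoc (α := fun _ => EuclideanSpace ℝ (Fin (n + 1))) V (crossProductN V)

/-- The speed `‖f'‖` of the curve `f : I → ℝᵈ`. -/
def curveSpeed {d : ℕ} (f : ℝ → EuclideanSpace ℝ (Fin d)) (I : Set ℝ) (t : ℝ) : ℝ :=
  ‖derivWithin f I t‖

/-- The curvatures `κ₁, …, κₙ` of an `n`-regular curve `f : I → ℝⁿ⁺¹` (with indices shifted by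
one): `κⱼ` is the coefficient in the Frenet equation
`Vⱼ' = - κⱼ₋₁ ν Vⱼ₋₁ + κⱼ ν Vⱼ₊₁`, that is, `κⱼ = (Vⱼ' ⬝ Vⱼ₊₁) / ν`. -/
def frenetCurvature {n : ℕ} (f : ℝ → EuclideanSpace ℝ (Fin (n + 1))) (I : Set ℝ)
    (j : Fin n) (t : ℝ) : ℝ :=
  inner ℝ (derivWithin (fun s => frenetFrame f I s j.castSucc) I t) (frenetFrame f I t j.succ)
    / curveSpeed f I t

/-- The generalized circular helix
`t ↦ (r₁ cos a₁t, r₁ sin a₁t, …, rₘ cos aₘt, rₘ sin aₘt, b t)` in `ℝ²ᵐ⁺¹`, that is,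
`t ↦ (r₁ e^{i a₁ t}, …, rₘ e^{i aₘ t}, b t)` under `ℝ²ᵐ⁺¹ = ℂᵐ × ℝ`. -/
def generalizedHelix {m : ℕ} (a r : Fin m → ℝ) (b : ℝ) (t : ℝ) :
    EuclideanSpace ℝ (Fin (2 * m + 1)) :=
  WithLp.toLp 2 fun i =>
    if h : (i : ℕ) / 2 < m then
      if (i : ℕ) % 2 = 0 then r ⟨i / 2, h⟩ * Real.cos (a ⟨i / 2, h⟩ * t)
      else r ⟨i / 2, h⟩ * Real.sin (a ⟨i / 2, h⟩ * t)
    else b * t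

end

/-! The Frenet frame satisfies `Vⱼ' = ∑ ωⱼₖ Vₖ` with `ω` constant, skew and tridiagonal. Skewness
makes the operator whose matrix in the moving frame is `ω` independent of time, so one fixed skew
operator `A` satisfies `Vⱼ' = A Vⱼ` (`exists_skew_operator`), and `g = f' = ν V₁` solves `g' = A g`.

Nonzero curvatures make `V₁` a cyclic vector of `A` (`mem_of_tridiagonal`). Splitting a cyclic
vector along the eigenspaces of the symmetric operator `A²` and counting dimensions in `ℝ²ᵐ⁺¹`
leaves exactly `m` distinct nonzero frequencies and a nonzero kernel component
(`exists_rotation_decomposition`). Hence `g` is a sum of `m` plane rotations and a constant; its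
primitive is a sum of circles and a line in mutually orthogonal subspaces, which is the helix up to
an isometry (`exists_isometryEquiv_generalizedHelix`). -/

/-! ### Cross products, Gram–Schmidt and constancy lemmas -/

theorem inner_crossProductN {n : ℕ} (w : Fin n → EuclideanSpace ℝ (Fin (n + 1)))
    (x : EuclideanSpace ℝ (Fin (n + 1))) :
    inner ℝ (crossProductN w) x = Matrix.det (Matrix.of
      (Fin.snoc (α := fun _ => Fin (n + 1) → ℝ) (fun k => (w k).ofLp) x.ofLp)) := by
  let D : (Fin (n + 1) → ℝ) →ₗ[ℝ] ℝ :=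
    (Matrix.detRowAlternating (n := Fin (n + 1)) (R := ℝ)).toMultilinearMap.toLinearMap
      (Fin.snoc (α := fun _ => Fin (n + 1) → ℝ) (fun k => (w k).ofLp) 0) (Fin.last n)
  have hD (y : Fin (n + 1) → ℝ) : D y = Matrix.det (Matrix.of
      (Fin.snoc (α := fun _ => Fin (n + 1) → ℝ) (fun k => (w k).ofLp) y)) := by
    simp only [D, MultilinearMap.toLinearMap_apply, Fin.update_snoc_last]
    rfl
  rw [← hD, D.pi_apply_eq_sum_univ, PiLp.inner_apply]
  refine Finset.sum_congr rfl fun i _ => ?_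
  have : (fun j => if i = j then (1 : ℝ) else 0) = Pi.single i 1 := by
    ext j; simp [Pi.single_apply, eq_comm]
  rw [this, hD]
  simp [crossProductN]

theorem inner_crossProductN_self {n : ℕ} (w : Fin n → EuclideanSpace ℝ (Fin (n + 1)))
    (k : Fin n) : inner ℝ (crossProductN w) (w k) = 0 := by
  rw [inner_crossProductN]
  refine Matrix.det_zero_of_row_eq (i := k.castSucc) (j := Fin.last n)
    (Fin.castSucc_lt_last k).ne ?_
  ext j
  simp

/-- Extend `w` to an orthonormal basis `b`. The cross product is orthogonal to every vector of `b`
but the last, and its coefficient there is the determinant of an orthogonal matrix, so its norm is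
1. -/
theorem Orthonormal.snoc_crossProductN {n : ℕ} {w : Fin n → EuclideanSpace ℝ (Fin (n + 1))}
    (hw : Orthonormal ℝ w) : Orthonormal ℝ
      (Fin.snoc (α := fun _ => EuclideanSpace ℝ (Fin (n + 1))) w (crossProductN w)) := by
  classical
  obtain ⟨b, hb⟩ := Orthonormal.exists_orthonormalBasis_extension_of_card_eq
    (𝕜 := ℝ) (E := EuclideanSpace ℝ (Fin (n + 1))) (ι := Fin (n + 1)) (by simp)
    (v := Fin.snoc (α := fun _ => EuclideanSpace ℝ (Fin (n + 1))) w 0)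
    (s := Set.range Fin.castSucc) (by
      have := hw.comp (fun x : Set.range (Fin.castSucc (n := n)) => x.2.choose) (by
        intro x y hxy
        apply Subtype.ext
        rw [← x.2.choose_spec, ← y.2.choose_spec]
        exact congrArg _ hxy)
      refine (congrArg (Orthonormal ℝ) ?_).mpr this
      funext x
      rw [Set.domRestrict_apply]
      conv_lhs => rw [← x.2.choose_spec]
      simp)
  have hbw (k : Fin n) : b k.castSucc = w k := by
    rw [hb _ ⟨k, rfl⟩, Fin.snoc_castSucc]
  have hdet : inner ℝ (crossProductN w) (b (Fin.last n)) ^ 2 = 1 := by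
    rw [inner_crossProductN]
    set M : Matrix (Fin (n + 1)) (Fin (n + 1)) ℝ := Matrix.of
      (Fin.snoc (α := fun _ => Fin (n + 1) → ℝ) (fun k => (w k).ofLp) (b (Fin.last n)).ofLp)
    have hM : M = Matrix.of fun i j => b i j := by
      ext i j
      refine Fin.lastCases ?_ (fun k => ?_) i
      · simp [M]
      · simp [M, hbw]
    have hMM : M * M.transpose = 1 := by
      ext i j
      have := orthonormal_iff_ite.1 b.orthonormal j i
      rw [PiLp.inner_apply] at this
      simp only [hM, Matrix.mul_apply, Matrix.transpose_apply, Matrix.of_apply, Matrix.one_apply]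
      simpa [eq_comm] using this
    have := congrArg Matrix.det hMM
    rwa [Matrix.det_mul, Matrix.det_transpose, Matrix.det_one, ← sq] at this
  have hnorm : ‖crossProductN w‖ = 1 := by
    have h := b.sum_sq_norm_inner_right (crossProductN w)
    rw [Fin.sum_univ_castSucc] at h
    simp only [hbw, real_inner_comm _ (w _), real_inner_comm _ (b _),
      inner_crossProductN_self] at h
    rw [real_inner_comm] at h
    simp only [Real.norm_eq_abs, sq_abs] at h
    rw [real_inner_comm] at hdet
    simp [hdet] at h
    nlinarith [norm_nonneg (crossProductN w)]
  refine ⟨fun i => ?_, fun i j hij => ?_⟩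
  · refine Fin.lastCases ?_ (fun k => ?_) i
    · simpa using hnorm
    · simpa using hw.1 k
  · revert hij
    refine Fin.lastCases ?_ (fun k => ?_) i
    · refine Fin.lastCases ?_ (fun l => ?_) j
      · simp
      · simpa using fun _ => inner_crossProductN_self w l
    · refine Fin.lastCases ?_ (fun l => ?_) j
      · intro _
        simpa [real_inner_comm] using inner_crossProductN_self w k
      · intro h
        simpa using hw.2 (fun h' => h (congrArg _ h'))

theorem differentiableOn_crossProductN {n : ℕ}
    {w : Fin n → ℝ → EuclideanSpace ℝ (Fin (n + 1))} {I : Set ℝ}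
    (hw : ∀ k, DifferentiableOn ℝ (w k) I) :
    DifferentiableOn ℝ (fun t => crossProductN fun k => w k t) I := by
  rw [differentiableOn_euclidean]
  intro i
  simp only [crossProductN, Matrix.det_apply, Matrix.of_apply]
  refine DifferentiableOn.fun_sum fun σ _ => DifferentiableOn.const_smul ?_ _
  refine DifferentiableOn.fun_finsetProd fun j _ => ?_
  refine Fin.lastCases ?_ (fun k => ?_) (σ j)
  · simp
  · simpa using (differentiableOn_euclidean.1 (hw k)) j

open InnerProductSpace in
theorem differentiableOn_gramSchmidt {E : Type*} [NormedAddCommGroup E] [InnerProductSpace ℝ E]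
    {n : ℕ} {g : Fin n → ℝ → E} {I : Set ℝ} (hg : ∀ j, DifferentiableOn ℝ (g j) I)
    (hli : ∀ t ∈ I, LinearIndependent ℝ fun j => g j t) (j : Fin n) :
    DifferentiableOn ℝ (fun t => gramSchmidt ℝ (fun j => g j t) j) I := by
  induction j using WellFoundedLT.induction with
  | ind j ih =>
    have h (t : ℝ) : gramSchmidt ℝ (fun j => g j t) j =
        g j t - ∑ i ∈ Finset.Iio j,
          (inner ℝ (gramSchmidt ℝ (fun j => g j t) i) (g j t) /
            (‖gramSchmidt ℝ (fun j => g j t) i‖ ^ 2)) •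
              gramSchmidt ℝ (fun j => g j t) i :=
      eq_sub_of_add_eq (gramSchmidt_def'' ℝ (fun j => g j t) j).symm
    simp only [h]
    refine (hg j).sub (DifferentiableOn.fun_sum fun i hi => ?_)
    have hi' := ih i (Finset.mem_Iio.1 hi)
    refine DifferentiableOn.smul (DifferentiableOn.div (hi'.inner ℝ (hg j)) (hi'.norm_sq ℝ) ?_) hi'
    intro t ht
    have := gramSchmidt_ne_zero (𝕜 := ℝ) i (hli t ht)
    positivity

open InnerProductSpace in
theorem differentiableOn_gramSchmidtNormed {E : Type*} [NormedAddCommGroup E]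
    [InnerProductSpace ℝ E]
    {n : ℕ} {g : Fin n → ℝ → E} {I : Set ℝ} (hg : ∀ j, DifferentiableOn ℝ (g j) I)
    (hli : ∀ t ∈ I, LinearIndependent ℝ fun j => g j t) (j : Fin n) :
    DifferentiableOn ℝ (fun t => gramSchmidtNormed ℝ (fun j => g j t) j) I := by
  have h := differentiableOn_gramSchmidt hg hli j
  have h0 (t : ℝ) (ht : t ∈ I) := gramSchmidt_ne_zero (𝕜 := ℝ) j (hli t ht)
  exact ((h.norm ℝ h0).inv fun t ht => norm_ne_zero_iff.2 (h0 t ht)).smul h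

open InnerProductSpace in
/-- A vector of an orthonormalized family is orthogonal to the earlier vectors of the original
family. -/
theorem inner_gramSchmidtNormed_of_lt {E : Type*} [NormedAddCommGroup E] [InnerProductSpace ℝ E]
    {n : ℕ} (v : Fin n → E) {i k : Fin n} (hik : i < k) :
    inner ℝ (gramSchmidtNormed ℝ v k) (v i) = 0 := by
  rw [gramSchmidtNormed, real_inner_smul_left, gramSchmidt_inv_triangular ℝ v hik, mul_zero]

open InnerProductSpace in
theorem gramSchmidtNormed_mem_span {E : Type*} [NormedAddCommGroup E] [InnerProductSpace ℝ E]
    {n : ℕ} (v : Fin n → E) (j : Fin n) :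
    gramSchmidtNormed ℝ v j ∈ Submodule.span ℝ (v '' Set.Iic j) :=
  Submodule.smul_mem _ _ (gramSchmidt_mem_span ℝ v le_rfl)

theorem eq_of_hasDerivWithinAt_eq_zero {F : Type*} [NormedAddCommGroup F] [NormedSpace ℝ F]
    {g : ℝ → F} {I : Set ℝ} (hI : Convex ℝ I) (hI' : UniqueDiffOn ℝ I)
    (hg : ∀ t ∈ I, HasDerivWithinAt g 0 I t) {s t : ℝ} (hs : s ∈ I) (ht : t ∈ I) : g s = g t := by
  refine hI.is_const_of_fderivWithin_eq_zero (𝕜 := ℝ)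
    (fun s hs => (hg s hs).differentiableWithinAt) (fun s hs => ?_) hs ht
  simpa using (hg s hs).hasFDerivWithinAt.fderivWithin (hI' s hs)

theorem inner_derivWithin_eq_neg {E : Type*} [NormedAddCommGroup E] [InnerProductSpace ℝ E]
    {u v : ℝ → E} {I : Set ℝ} {t c : ℝ} (hI : UniqueDiffWithinAt ℝ I t) (ht : t ∈ I)
    (hu : DifferentiableWithinAt ℝ u I t) (hv : DifferentiableWithinAt ℝ v I t)
    (h : ∀ s ∈ I, inner ℝ (u s) (v s) = c) :
    inner ℝ (derivWithin u I t) (v t) = -inner ℝ (u t) (derivWithin v I t) := by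
  have h1 := hu.hasDerivWithinAt.inner ℝ hv.hasDerivWithinAt
  have h2 : HasDerivWithinAt (fun s => inner ℝ (u s) (v s)) 0 I t :=
    (hasDerivWithinAt_const t I c).congr h (h t ht)
  linarith [hI.eq_deriv _ h1 h2]

/-! ### The Frenet equations -/

section Frenet

variable {n : ℕ} {f : ℝ → EuclideanSpace ℝ (Fin (n + 1))} {I : Set ℝ}

theorem orthonormal_frenetFrame (hreg : IsRegularCurve n f I) {t : ℝ} (ht : t ∈ I) :
    Orthonormal ℝ (frenetFrame f I t) :=
  (InnerProductSpace.gramSchmidtNormed_orthonormal (hreg t ht)).snoc_crossProductN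

theorem frenetFrame_castSucc (t : ℝ) (j : Fin n) : frenetFrame f I t j.castSucc =
    InnerProductSpace.gramSchmidtNormed ℝ (fun j : Fin n => iteratedDerivWithin (j + 1) f I t) j := by
  simp [frenetFrame]

theorem frenetFrame_last (t : ℝ) : frenetFrame f I t (Fin.last n) =
    crossProductN fun j : Fin n => frenetFrame f I t j.castSucc := by
  simp [frenetFrame]

theorem differentiableOn_frenetFrame (hI : UniqueDiffOn ℝ I)
    (hf : ContDiffOn ℝ (n + 1 : ℕ) f I) (hreg : IsRegularCurve n f I) (j : Fin (n + 1)) :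
    DifferentiableOn ℝ (fun t => frenetFrame f I t j) I := by
  have h (j : Fin n) : DifferentiableOn ℝ (fun t => frenetFrame f I t j.castSucc) I := by
    simp only [frenetFrame_castSucc]
    refine differentiableOn_gramSchmidtNormed
      (g := fun j : Fin n => iteratedDerivWithin (j + 1) f I) (fun i => ?_) hreg j
    exact hf.differentiableOn_iteratedDerivWithin (by exact_mod_cast Nat.succ_lt_succ i.2) hI
  refine Fin.lastCases ?_ h j
  simp only [frenetFrame_last]
  exact differentiableOn_crossProductN h

theorem inner_frenetFrame_iteratedDerivWithin {t : ℝ} {k : Fin (n + 1)} {i : Fin n} (hik : (i : ℕ) < k) :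
    inner ℝ (frenetFrame f I t k) (iteratedDerivWithin (i + 1) f I t) = 0 := by
  revert hik
  refine Fin.lastCases (fun _ => ?_) (fun k hik => ?_) k
  · have h : iteratedDerivWithin (i + 1) f I t ∈
        Submodule.span ℝ (Set.range fun j : Fin n => frenetFrame f I t j.castSucc) := by
      simp only [frenetFrame_castSucc]
      rw [InnerProductSpace.span_gramSchmidtNormed_range, InnerProductSpace.span_gramSchmidt]
      exact Submodule.subset_span ⟨i, rfl⟩
    rw [frenetFrame_last]
    generalize iteratedDerivWithin (i + 1) f I t = y at h
    induction h using Submodule.span_induction with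
    | mem x hx =>
      obtain ⟨j, rfl⟩ := hx
      exact inner_crossProductN_self (fun j : Fin n => frenetFrame f I t j.castSucc) j
    | zero => simp
    | add x y _ _ hx hy => rw [inner_add_right, hx, hy, add_zero]
    | smul a x _ hx => rw [real_inner_smul_right, hx, mul_zero]
  · rw [frenetFrame_castSucc]
    exact inner_gramSchmidtNormed_of_lt
      (fun j : Fin n => iteratedDerivWithin (j + 1) f I t) (Fin.lt_def.2 hik)

/-- `Vⱼ` is a combination of derivatives `f⁽ⁱ⁺¹⁾` with `i ≤ j`. Differentiating `Vₖ ⬝ f⁽ⁱ⁺¹⁾ = 0`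
moves the derivative onto `f⁽ⁱ⁺²⁾`, still orthogonal to `Vₖ` because `j + 1 < k`. -/
theorem inner_derivWithin_frenetFrame_eq_zero (hI : UniqueDiffOn ℝ I)
    (hf : ContDiffOn ℝ (n + 1 : ℕ) f I) (hreg : IsRegularCurve n f I) {t : ℝ} (ht : t ∈ I)
    {j k : Fin (n + 1)} (hjk : (j : ℕ) + 1 < k) :
    inner ℝ (derivWithin (fun s => frenetFrame f I s k) I t) (frenetFrame f I t j) = 0 := by
  have hjn : (j : ℕ) < n := by omega
  obtain ⟨j, rfl⟩ : ∃ j' : Fin n, j'.castSucc = j := ⟨⟨j, hjn⟩, rfl⟩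
  rw [frenetFrame_castSucc]
  have h := gramSchmidtNormed_mem_span (fun j : Fin n => iteratedDerivWithin (j + 1) f I t) j
  generalize InnerProductSpace.gramSchmidtNormed ℝ
    (fun j : Fin n => iteratedDerivWithin (j + 1) f I t) j = y at h
  induction h using Submodule.span_induction with
  | mem x hx =>
    obtain ⟨i, hi, rfl⟩ := hx
    have hij : (i : ℕ) ≤ j := hi
    simp only [Fin.val_castSucc] at hjk
    have hin : (i : ℕ) + 1 < n := by omega
    rw [inner_derivWithin_eq_neg (c := 0) (u := fun s => frenetFrame f I s k)
      (v := iteratedDerivWithin (i + 1) f I) (hI t ht) ht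
      (differentiableOn_frenetFrame hI hf hreg k t ht)
      (hf.differentiableOn_iteratedDerivWithin (by exact_mod_cast Nat.succ_lt_succ i.2) hI t ht)
      (fun s _ => inner_frenetFrame_iteratedDerivWithin (by omega)),
      ← iteratedDerivWithin_succ, neg_eq_zero]
    exact inner_frenetFrame_iteratedDerivWithin (i := ⟨i + 1, hin⟩)
      (show (i : ℕ) + 1 < k by omega)
  | zero => simp
  | add x y _ _ hx hy => rw [inner_add_right, hx, hy, add_zero]
  | smul a x _ hx => rw [real_inner_smul_right, hx, mul_zero]

/-- The Frenet equations of a curve with constant speed and constant curvatures. -/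
theorem exists_frenet_equations (hI : UniqueDiffOn ℝ I) (hne : I.Nonempty)
    (hf : ContDiffOn ℝ (n + 1 : ℕ) f I) (hreg : IsRegularCurve n f I) {ν : ℝ} (hν : ν ≠ 0)
    (hspeed : ∀ t ∈ I, curveSpeed f I t = ν) {κ : Fin n → ℝ}
    (hcurv : ∀ j : Fin n, ∀ t ∈ I, frenetCurvature f I j t = κ j) :
    ∃ ω : Fin (n + 1) → Fin (n + 1) → ℝ, (∀ j k, ω j k = -ω k j) ∧
      (∀ j : Fin n, ω j.castSucc j.succ = κ j * ν) ∧
      (∀ j k : Fin (n + 1), (j : ℕ) + 1 < k → ω j k = 0) ∧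
      ∀ t ∈ I, ∀ j, HasDerivWithinAt (fun s => frenetFrame f I s j)
        (∑ k, ω j k • frenetFrame f I t k) I t := by
  have hd := differentiableOn_frenetFrame hI hf hreg
  have hskew (t : ℝ) (ht : t ∈ I) (j k : Fin (n + 1)) :
      inner ℝ (derivWithin (fun s => frenetFrame f I s j) I t) (frenetFrame f I t k) =
        -inner ℝ (derivWithin (fun s => frenetFrame f I s k) I t) (frenetFrame f I t j) := by
    rw [inner_derivWithin_eq_neg (hI t ht) ht (hd j t ht) (hd k t ht)
      (fun s hs => orthonormal_iff_ite.1 (orthonormal_frenetFrame hreg hs) j k), real_inner_comm]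
  have hsucc (t : ℝ) (ht : t ∈ I) (j : Fin n) :
      inner ℝ (derivWithin (fun s => frenetFrame f I s j.castSucc) I t)
        (frenetFrame f I t j.succ) = κ j * ν := by
    rw [← hcurv j t ht, frenetCurvature, hspeed t ht, div_mul_cancel₀ _ hν]
  have hfar (t : ℝ) (ht : t ∈ I) (j k : Fin (n + 1)) (hjk : (j : ℕ) + 1 < k) :
      inner ℝ (derivWithin (fun s => frenetFrame f I s j) I t) (frenetFrame f I t k) = 0 := by
    rw [hskew t ht, inner_derivWithin_frenetFrame_eq_zero hI hf hreg ht hjk, neg_zero]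
  obtain ⟨t₀, ht₀⟩ := hne
  refine ⟨fun j k => inner ℝ (derivWithin (fun s => frenetFrame f I s j) I t₀)
    (frenetFrame f I t₀ k), hskew t₀ ht₀, hsucc t₀ ht₀, hfar t₀ ht₀, fun t ht j => ?_⟩
  -- Above the diagonal a coefficient is either 0 or `κⱼ ν`, so it does not depend on time; skewness
  -- covers the rest.
  have hlt (j k : Fin (n + 1)) (hjk : j < k) :
      inner ℝ (derivWithin (fun s => frenetFrame f I s j) I t₀) (frenetFrame f I t₀ k) =
      inner ℝ (derivWithin (fun s => frenetFrame f I s j) I t) (frenetFrame f I t k) := by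
    rw [Fin.lt_def] at hjk
    obtain h | h := Nat.lt_or_eq_of_le (Nat.succ_le_of_lt hjk)
    · rw [hfar t₀ ht₀ j k h, hfar t ht j k h]
    · obtain ⟨i, rfl⟩ : ∃ i : Fin n, i.castSucc = j := ⟨⟨j, by omega⟩, rfl⟩
      obtain rfl : i.succ = k := Fin.ext h
      rw [hsucc t₀ ht₀, hsucc t ht]
  have hconst (k : Fin (n + 1)) :
      inner ℝ (derivWithin (fun s => frenetFrame f I s j) I t₀) (frenetFrame f I t₀ k) =
      inner ℝ (derivWithin (fun s => frenetFrame f I s j) I t) (frenetFrame f I t k) := by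
    obtain h | rfl | h := lt_trichotomy j k
    · exact hlt j k h
    · linarith [hskew t ht j j, hskew t₀ ht₀ j j]
    · rw [hskew t₀ ht₀, hskew t ht, hlt k j h]
  simp only [hconst]
  have ho := orthonormal_frenetFrame hreg ht
  let b := (basisOfOrthonormalOfCardEqFinrank ho (by simp)).toOrthonormalBasis (by simpa using ho)
  have hb (k : Fin (n + 1)) : b k = frenetFrame f I t k := by simp [b]
  have := b.sum_repr' (derivWithin (fun s => frenetFrame f I s j) I t)
  simp only [hb] at this
  refine (hd j t ht).hasDerivWithinAt.congr_deriv
    (this.symm.trans (Finset.sum_congr rfl fun k _ => ?_))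
  rw [real_inner_comm]

end Frenet

/-! ### From a moving frame to a fixed skew operator -/

section Skew

variable {E : Type*} [NormedAddCommGroup E] [InnerProductSpace ℝ E]

/-- An orthonormal frame satisfying linear equations with constant skew-symmetric coefficients is
moved by a fixed skew-symmetric operator. -/
theorem exists_skew_operator {ι : Type*} [Fintype ι] {V : ℝ → ι → E} {I : Set ℝ}
    (hI : Convex ℝ I) (hI' : UniqueDiffOn ℝ I) {t₀ : ℝ} (ht₀ : t₀ ∈ I) {ω : ι → ι → ℝ}
    (hω : ∀ j k, ω j k = -ω k j) (ho : ∀ t ∈ I, Orthonormal ℝ (V t))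
    (hV : ∀ t ∈ I, ∀ j, HasDerivWithinAt (fun s => V s j) (∑ k, ω j k • V t k) I t) :
    ∃ A : E →ₗ[ℝ] E, (∀ x y, inner ℝ (A x) y = -inner ℝ x (A y)) ∧
      ∀ t ∈ I, ∀ j, A (V t j) = ∑ k, ω j k • V t k := by
  classical
  -- `Φ t` has the coefficients `ω` in the frame `V t`; its derivative in `t` vanishes by skewness.
  let Φ (t : ℝ) : E →ₗ[ℝ] E := ∑ j, ∑ k, ω j k • (innerₛₗ ℝ (V t j)).smulRight (V t k)
  have hΦ (t : ℝ) (x : E) : Φ t x = ∑ j, ∑ k, ω j k • inner ℝ (V t j) x • V t k := by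
    simp [Φ, LinearMap.sum_apply]
  have hconst (t : ℝ) (ht : t ∈ I) (x : E) : Φ t₀ x = Φ t x := by
    have hder (s : ℝ) (hs : s ∈ I) : HasDerivWithinAt (fun s => Φ s x) 0 I s := by
      have h : HasDerivWithinAt (fun s => Φ s x) (∑ j, ∑ k, ω j k •
          (inner ℝ (V s j) x • (∑ l, ω k l • V s l) +
            (inner ℝ (V s j) (0 : E) + inner ℝ (∑ l, ω j l • V s l) x) • V s k)) I s := by
        simp only [hΦ]
        exact HasDerivWithinAt.fun_sum fun j _ => HasDerivWithinAt.fun_sum fun k _ =>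
          (((hV s hs j).inner ℝ (hasDerivWithinAt_const s I x)).smul (hV s hs k)).const_smul _
      convert h using 1
      simp only [inner_zero_right, zero_add, smul_add, Finset.sum_add_distrib, Finset.smul_sum,
        sum_inner, Finset.sum_smul, real_inner_smul_left, smul_smul]
      rw [eq_comm, add_eq_zero_iff_eq_neg]
      -- Reordering the second triple sum matches it term by term with the first, up to the sign in
      -- `ω l j = -ω j l`.
      have h1 : (∑ j, ∑ k, ∑ l, (ω j k * (ω j l * inner ℝ (V s l) x)) • V s k) =
          ∑ l, ∑ j, ∑ k, (ω j k * (ω j l * inner ℝ (V s l) x)) • V s k := by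
        rw [Finset.sum_comm' (t' := Finset.univ) (s' := fun _ => Finset.univ) (by simp)]
        conv_rhs =>
          rw [Finset.sum_comm]
          enter [2, j]
          rw [Finset.sum_comm]
        rw [Finset.sum_comm]
      rw [h1, ← Finset.sum_neg_distrib]
      refine Finset.sum_congr rfl fun l _ => ?_
      rw [← Finset.sum_neg_distrib]
      refine Finset.sum_congr rfl fun j _ => ?_
      rw [← Finset.sum_neg_distrib]
      refine Finset.sum_congr rfl fun k _ => ?_
      rw [← neg_smul, hω l j]
      congr 1
      ring
    exact eq_of_hasDerivWithinAt_eq_zero hI hI' hder ht₀ ht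
  refine ⟨Φ t₀, fun x y => ?_, fun t ht j => ?_⟩
  · simp only [hΦ, sum_inner, inner_sum, real_inner_smul_left, real_inner_smul_right]
    rw [Finset.sum_comm, ← Finset.sum_neg_distrib]
    refine Finset.sum_congr rfl fun j _ => ?_
    rw [← Finset.sum_neg_distrib]
    refine Finset.sum_congr rfl fun k _ => ?_
    rw [hω k j, real_inner_comm x]
    ring
  · rw [hconst t ht, hΦ, Finset.sum_eq_single j]
    · simp [(ho t ht).1 j]
    · intro i _ hij
      simp [(ho t ht).2 hij]
    · simp

/-- For tridiagonal coefficients the first frame vector is a cyclic vector of the operator. -/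
theorem mem_of_tridiagonal {n : ℕ} {v : Fin (n + 1) → E} {A : E →ₗ[ℝ] E}
    {ω : Fin (n + 1) → Fin (n + 1) → ℝ}
    (hsucc : ∀ j : Fin n, ω j.castSucc j.succ ≠ 0)
    (hfar : ∀ j k : Fin (n + 1), (j : ℕ) + 1 < k → ω j k = 0)
    (hA : ∀ j, A (v j) = ∑ k, ω j k • v k) {S : Submodule ℝ E} (hS : ∀ x ∈ S, A x ∈ S)
    (h0 : v 0 ∈ S) (j : Fin (n + 1)) : v j ∈ S := by
  induction j using WellFoundedLT.induction with
  | ind j ih =>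
    revert ih
    refine Fin.cases (fun _ => h0) (fun j ih => ?_) j
    have hA' := hS _ (ih j.castSucc (Fin.castSucc_lt_succ))
    -- In `A (v j)` the terms before `j + 1` lie in `S` by induction and those after vanish, so the
    -- term with nonzero coefficient at `j + 1` lies in `S` too.
    rw [hA, ← Finset.add_sum_erase _ _ (Finset.mem_univ j.succ)] at hA'
    have hrest : ∑ k ∈ Finset.univ.erase j.succ, ω j.castSucc k • v k ∈ S := by
      refine S.sum_mem fun k hk => ?_
      obtain h | h := lt_or_gt_of_ne (Finset.ne_of_mem_erase hk)
      · exact S.smul_mem _ (ih k h)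
      · rw [hfar _ _ (by simpa using Fin.lt_def.1 h), zero_smul]
        exact S.zero_mem
    exact (S.smul_mem_iff (hsucc j)).1 ((S.add_mem_iff_left hrest).1 hA')

end Skew

/-! ### Spectral decomposition of a skew operator -/

section SkewDecomposition

variable {E : Type*} [NormedAddCommGroup E] [InnerProductSpace ℝ E] {A : E →ₗ[ℝ] E}

theorem inner_eq_zero_of_skew (hA : ∀ x y, inner ℝ (A x) y = -inner ℝ x (A y)) {x y : E}
    {α β : ℝ} (hx : A (A x) = α • x) (hy : A (A y) = β • y) (h : α ≠ β) : inner ℝ x y = 0 := by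
  have h1 : inner ℝ (A (A x)) y = inner ℝ x (A (A y)) := by rw [hA, hA, neg_neg]
  rw [hx, hy, real_inner_smul_left, real_inner_smul_right] at h1
  exact (mul_eq_zero.1 (by linarith : (α - β) * inner ℝ x y = 0)).resolve_left (sub_ne_zero.2 h)

theorem inner_apply_self_of_skew (hA : ∀ x y, inner ℝ (A x) y = -inner ℝ x (A y)) (x : E) :
    inner ℝ (A x) x = 0 := by
  linarith [hA x x, real_inner_comm x (A x)]

/-- Beyond giving lengths, this forces eigenvalues of `A²` to be nonpositive and `ker A² = ker A`.
-/
theorem norm_sq_apply_of_skew (hA : ∀ x y, inner ℝ (A x) y = -inner ℝ x (A y)) {x : E} {α : ℝ}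
    (hx : A (A x) = -α • x) : ‖A x‖ ^ 2 = α * ‖x‖ ^ 2 := by
  rw [← real_inner_self_eq_norm_sq, hA, hx, real_inner_smul_right, real_inner_self_eq_norm_sq]
  ring

/-- The plane spanned by `p i` and `A (p i)` rotates under `A`; these are orthonormal bases of all
these planes. -/
noncomputable def rotationFrame {ι : Type*} (A : E →ₗ[ℝ] E) (a : ι → ℝ) (p : ι → E) : ι × Fin 2 → E :=
  fun x => if x.2 = 0 then -(a x.1 * ‖p x.1‖)⁻¹ • A (p x.1) else ‖p x.1‖⁻¹ • p x.1

/-- Inside a plane `A p ⊥ p`. Across planes all vectors are eigenvectors of `A²` with distinct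
eigenvalues, since `A` commutes with `A²`. -/
theorem orthonormal_rotationFrame {ι : Type*}
    (hA : ∀ x y, inner ℝ (A x) y = -inner ℝ x (A y)) {a : ι → ℝ} {p : ι → E}
    (ha : ∀ i, 0 < a i) (hinj : Function.Injective a) (hp : ∀ i, p i ≠ 0)
    (hAp : ∀ i, A (A (p i)) = -(a i ^ 2) • p i) : Orthonormal ℝ (rotationFrame A a p) := by
  have hAAp (i : ι) : A (A (A (p i))) = -(a i ^ 2) • A (p i) := by rw [hAp, map_smul]
  have hne {i j : ι} (hij : i ≠ j) : -(a i ^ 2) ≠ -(a j ^ 2) := fun h => hij <| hinj <|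
    (pow_left_inj₀ (ha i).le (ha j).le two_ne_zero).1 (neg_injective h)
  have hnorm (i : ι) : ‖A (p i)‖ = a i * ‖p i‖ := by
    have := norm_sq_apply_of_skew hA (hAp i)
    rw [← mul_pow] at this
    exact (pow_left_inj₀ (norm_nonneg _) (mul_nonneg (ha i).le (norm_nonneg _)) two_ne_zero).1 this
  have hself (i : ι) := inner_apply_self_of_skew hA (p i)
  have hself' (i : ι) : inner ℝ (p i) (A (p i)) = 0 := by rw [real_inner_comm, hself]
  constructor
  · rintro ⟨i, k⟩
    have h1 := norm_pos_iff.2 (hp i)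
    have h2 := ha i
    fin_cases k
    · simp [rotationFrame, norm_smul, hnorm, abs_of_pos h2]
      field_simp
    · simp [rotationFrame, norm_smul]
      field_simp
  · rintro ⟨i, k⟩ ⟨j, l⟩ hne'
    by_cases hij : i = j
    · subst hij
      fin_cases k <;> fin_cases l <;>
        simp_all [rotationFrame, real_inner_smul_left, real_inner_smul_right]
    · have h1 := inner_eq_zero_of_skew hA (hAp i) (hAp j) (hne hij)
      have h2 := inner_eq_zero_of_skew hA (hAAp i) (hAp j) (hne hij)
      have h3 := inner_eq_zero_of_skew hA (hAp i) (hAAp j) (hne hij)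
      have h4 := inner_eq_zero_of_skew hA (hAAp i) (hAAp j) (hne hij)
      fin_cases k <;> fin_cases l <;>
        simp [rotationFrame, real_inner_smul_left, real_inner_smul_right, h1, h2, h3, h4]

theorem orthonormal_rotationFrame_sum {ι : Type*}
    (hA : ∀ x y, inner ℝ (A x) y = -inner ℝ x (A y)) {a : ι → ℝ} {p : ι → E} {p₀ : E}
    (ha : ∀ i, 0 < a i) (hinj : Function.Injective a) (hp : ∀ i, p i ≠ 0)
    (hAp : ∀ i, A (A (p i)) = -(a i ^ 2) • p i) (hp₀ : p₀ ≠ 0) (hAp₀ : A p₀ = 0) :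
    Orthonormal ℝ (Sum.elim (rotationFrame A a p) fun _ : Unit => ‖p₀‖⁻¹ • p₀) := by
  have h := orthonormal_rotationFrame hA ha hinj hp hAp
  have h1 (i : ι) : inner ℝ (p i) p₀ = 0 := by
    refine inner_eq_zero_of_skew hA (hAp i) (β := 0) (by simp [hAp₀]) ?_
    have := ha i
    simp [this.ne']
  have h2 (i : ι) : inner ℝ (A (p i)) p₀ = 0 := by rw [hA, hAp₀, inner_zero_right, neg_zero]
  have h3 (x : ι × Fin 2) : inner ℝ (rotationFrame A a p x) p₀ = 0 := by
    rw [rotationFrame]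
    split_ifs <;> simp [real_inner_smul_left, h1, h2]
  constructor
  · rintro (x | x)
    · exact h.1 x
    · have := norm_pos_iff.2 hp₀
      simp [norm_smul, this.ne']
  · rintro (x | x) (y | y) hxy
    · exact h.2 fun h => hxy (congrArg _ h)
    · simp [real_inner_smul_right, h3]
    · rw [real_inner_comm]
      simp [real_inner_smul_right, h3]
    · exact absurd rfl hxy

/-- A skew-symmetric operator of an odd-dimensional space with a cyclic vector is a rotation of
planes with distinct speeds, and the cyclic vector has a nonzero component in each plane. -/
theorem exists_rotation_decomposition [FiniteDimensional ℝ E]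
    (hA : ∀ x y, inner ℝ (A x) y = -inner ℝ x (A y)) {m : ℕ}
    (hm : Module.finrank ℝ E = 2 * m + 1) {e : E}
    (he : ∀ S : Submodule ℝ E, (∀ x ∈ S, A x ∈ S) → e ∈ S → S = ⊤) :
    ∃ (a : Fin m → ℝ) (p : Fin m → E) (p₀ : E), (∀ i, 0 < a i) ∧ Function.Injective a ∧
      (∀ i, p i ≠ 0) ∧ (∀ i, A (A (p i)) = -(a i ^ 2) • p i) ∧ p₀ ≠ 0 ∧ A p₀ = 0 ∧
      e = ∑ i, p i + p₀ := by
  classical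
  have hT : (A ∘ₗ A).IsSymmetric := fun x y => by
    simp only [LinearMap.comp_apply]
    rw [hA, hA, neg_neg]
  have htop : (⨆ μ : ℝ, Module.End.eigenspace (A ∘ₗ A) μ) = ⊤ :=
    Submodule.orthogonal_eq_bot_iff.1 hT.orthogonalComplement_iSup_eigenspaces_eq_bot
  obtain ⟨c, hc, hce⟩ := (Submodule.mem_iSup_iff_exists_finsupp
    (fun μ : ℝ => Module.End.eigenspace (A ∘ₗ A) μ) e).1 (by rw [htop]; trivial)
  replace hc (μ : ℝ) : A (A (c μ)) = μ • c μ := Module.End.mem_eigenspace_iff.1 (hc μ)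
  -- Only the nonzero eigenvalues that occur in `e` are indexed; cyclicity will show that there are
  -- exactly `m`.
  let ι := {μ : ℝ // μ ∈ c.support.erase 0}
  have hne (μ : ι) : c μ ≠ 0 := Finsupp.mem_support_iff.1 (Finset.mem_of_mem_erase μ.2)
  have hneg (μ : ι) : (μ : ℝ) < 0 := by
    have h := norm_sq_apply_of_skew hA (α := -μ) (x := c μ) (by rw [neg_neg, hc])
    have h1 : (0 : ℝ) < ‖c μ‖ ^ 2 := by have := norm_pos_iff.2 (hne μ); positivity
    have h2 : (μ : ℝ) ≠ 0 := Finset.ne_of_mem_erase μ.2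
    refine lt_of_le_of_ne ?_ h2
    by_contra! h3
    nlinarith [sq_nonneg ‖A (c μ)‖, mul_pos h3 h1]
  let a : ι → ℝ := fun μ => √(-μ)
  have ha (μ : ι) : 0 < a μ := Real.sqrt_pos.2 (neg_pos.2 (hneg μ))
  have hsq (μ : ι) : a μ ^ 2 = -μ := Real.sq_sqrt (neg_pos.2 (hneg μ)).le
  have hinj : Function.Injective a := fun μ η h => by
    have := hsq μ
    rw [h, hsq η] at this
    exact Subtype.ext (neg_injective this.symm)
  have hAc (μ : ι) : A (A (c μ)) = -(a μ ^ 2) • c μ := by rw [hsq, neg_neg, hc]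
  have hA0 : A (c 0) = 0 := by
    have h := norm_sq_apply_of_skew hA (α := 0) (x := c 0) (by rw [hc]; simp)
    simpa using h
  have hsum : e = ∑ μ : ι, c μ + c 0 := by
    rw [← hce, Finsupp.sum, Finset.sum_coe_sort (c.support.erase 0) (fun μ => c μ)]
    by_cases h : (0 : ℝ) ∈ c.support
    · rw [Finset.sum_erase_add _ _ h]
    · rw [Finset.erase_eq_of_notMem h, Finsupp.notMem_support_iff.1 h, add_zero]
  let S : Submodule ℝ E :=
    Submodule.span ℝ (Set.range fun x : ι × Fin 2 => if x.2 = 0 then A (c x.1) else c x.1)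
  have hcS (μ : ι) : c μ ∈ S := Submodule.subset_span ⟨(μ, 1), by simp⟩
  have hAcS (μ : ι) : A (c μ) ∈ S := Submodule.subset_span ⟨(μ, 0), by simp⟩
  have hS (x : E) (hx : x ∈ S) : A x ∈ S := by
    induction hx using Submodule.span_induction with
    | mem x hx =>
      obtain ⟨⟨μ, k⟩, rfl⟩ := hx
      dsimp only
      split_ifs
      · rw [hAc]
        exact S.smul_mem _ (hcS μ)
      · exact hAcS μ
    | zero => simp
    | add x y _ _ hx hy => rw [map_add]; exact S.add_mem hx hy
    | smul r x _ hx => rw [map_smul]; exact S.smul_mem r hx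
  have hcard : Fintype.card (ι × Fin 2) = 2 * Fintype.card ι := by
    simp [mul_comm]
  have hSrank : Module.finrank ℝ S ≤ 2 * Fintype.card ι := by
    rw [← hcard]
    exact finrank_range_le_card _
  have hle : 2 * Fintype.card ι ≤ 2 * m + 1 := by
    rw [← hcard, ← hm]
    exact (orthonormal_rotationFrame hA ha hinj hne hAc).linearIndependent.fintype_card_le_finrank
  -- Adjoining `c 0` to `S` gives an invariant subspace containing `e`, hence the whole space.
  have hge : 2 * m + 1 ≤ 2 * Fintype.card ι + 1 := by
    have h := he (S ⊔ Submodule.span ℝ {c 0}) (fun x hx => ?_) ?_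
    · rw [← hm, ← finrank_top ℝ E, ← h]
      exact (Submodule.finrank_add_le_finrank_add_finrank _ _).trans
        (add_le_add hSrank ((finrank_span_le_card {c 0}).trans (by simp)))
    · obtain ⟨y, hy, z, hz, rfl⟩ := Submodule.mem_sup.1 hx
      obtain ⟨r, rfl⟩ := Submodule.mem_span_singleton.1 hz
      rw [map_add, map_smul, hA0, smul_zero, add_zero]
      exact Submodule.mem_sup_left (hS y hy)
    · rw [hsum]
      exact Submodule.add_mem_sup (S.sum_mem fun μ _ => hcS μ)
        (Submodule.mem_span_singleton_self _)
  have hcm : Fintype.card ι = m := by omega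
  -- Otherwise `S` itself contains `e` and is the whole space, although its dimension is at most `2
  -- * m`.
  have hc0 : c 0 ≠ 0 := fun h0 => by
    have h := he S hS (by rw [hsum, h0, add_zero]; exact S.sum_mem fun μ _ => hcS μ)
    rw [h, finrank_top, hm] at hSrank
    omega
  let σ : Fin m ≃ ι := (Fintype.equivFinOfCardEq hcm).symm
  refine ⟨fun i => a (σ i), fun i => c (σ i), c 0, fun i => ha _, hinj.comp σ.injective,
    fun i => hne _, fun i => hAc _, hc0, hA0, ?_⟩
  rw [hsum, σ.sum_comp fun μ : ι => c μ]

end SkewDecomposition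

/-! ### Explicit solutions of `x' = A x` and their primitives -/

section HelixODE

variable {E : Type*} [NormedAddCommGroup E] [InnerProductSpace ℝ E] {A : E →ₗ[ℝ] E}

/-- `‖g - h‖²` is constant, since its derivative is `2 ⟪A x, x⟫ = 0` with `x = g - h`. -/
theorem eqOn_of_skew_ode (hA : ∀ x y, inner ℝ (A x) y = -inner ℝ x (A y)) {g h : ℝ → E}
    {I : Set ℝ} (hI : Convex ℝ I) (hI' : UniqueDiffOn ℝ I)
    (hg : ∀ t ∈ I, HasDerivWithinAt g (A (g t)) I t)
    (hh : ∀ t ∈ I, HasDerivWithinAt h (A (h t)) I t) {t₀ : ℝ} (ht₀ : t₀ ∈ I)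
    (h₀ : g t₀ = h t₀) : Set.EqOn g h I := by
  intro t ht
  have key : inner ℝ (g t - h t) (g t - h t) = inner ℝ (g t₀ - h t₀) (g t₀ - h t₀) := by
    refine eq_of_hasDerivWithinAt_eq_zero (g := fun s => inner ℝ (g s - h s) (g s - h s))
      hI hI' (fun s hs => ?_) ht ht₀
    have hd := (hg s hs).fun_sub (hh s hs)
    refine (hd.inner ℝ hd).congr_deriv ?_
    rw [← map_sub, hA, add_neg_cancel]
  rw [h₀, sub_self, inner_zero_left, inner_self_eq_zero, sub_eq_zero] at key
  exact key

/-- The solution of `x' = A x` with initial value `p` where `A² p = - a² p`. -/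
noncomputable def planeRotation (A : E →ₗ[ℝ] E) (a : ℝ) (p : E) (t : ℝ) : E :=
  Real.cos (a * t) • p + (Real.sin (a * t) / a) • A p

theorem apply_planeRotation {a : ℝ} (ha : a ≠ 0) {p : E} (hp : A (A p) = -(a ^ 2) • p) (t : ℝ) :
    A (planeRotation A a p t) = -(a * Real.sin (a * t)) • p + Real.cos (a * t) • A p := by
  rw [planeRotation, map_add, map_smul, map_smul, hp, smul_smul, add_comm]
  congr 2
  field_simp

theorem apply_apply_planeRotation {a : ℝ} {p : E} (hp : A (A p) = -(a ^ 2) • p) (t : ℝ) :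
    A (A (planeRotation A a p t)) = -(a ^ 2) • planeRotation A a p t := by
  simp only [planeRotation, map_add, map_smul, hp]
  module

/-- The identity `exp(tA) exp(-tA) p = p`; it carries initial data from an arbitrary time back to
time 0. -/
theorem planeRotation_neg_self {a : ℝ} (ha : a ≠ 0) {p : E} (hp : A (A p) = -(a ^ 2) • p)
    (t : ℝ) : planeRotation A a (planeRotation A a p (-t)) t = p := by
  rw [planeRotation, apply_planeRotation ha hp, planeRotation, mul_neg, Real.cos_neg,
    Real.sin_neg]
  have h := Real.sin_sq_add_cos_sq (a * t)
  match_scalars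
  · field_simp
    linarith
  · field_simp
    ring

theorem hasDerivAt_planeRotation {a : ℝ} (ha : a ≠ 0) {p : E} (hp : A (A p) = -(a ^ 2) • p)
    (t : ℝ) : HasDerivAt (planeRotation A a p) (A (planeRotation A a p t)) t := by
  have h1 : HasDerivAt (fun t : ℝ => a * t) a t := by
    simpa using (hasDerivAt_id t).const_mul a
  rw [apply_planeRotation ha hp]
  refine ((h1.cos.smul_const p).add ((h1.sin.div_const a).smul_const (A p))).congr_deriv ?_
  match_scalars <;> field_simp

/-- A primitive of `planeRotation A a p`. -/
noncomputable def planeCircle (A : E →ₗ[ℝ] E) (a : ℝ) (p : E) (t : ℝ) : E :=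
  (‖p‖ / a * Real.cos (a * t)) • rotationFrame A (fun _ : Unit => a) (fun _ => p) ((), 0) +
    (‖p‖ / a * Real.sin (a * t)) • rotationFrame A (fun _ : Unit => a) (fun _ => p) ((), 1)

theorem hasDerivAt_planeCircle {a : ℝ} (ha : a ≠ 0) {p : E} (hp : p ≠ 0) (t : ℝ) :
    HasDerivAt (planeCircle A a p) (planeRotation A a p t) t := by
  have h1 : HasDerivAt (fun t : ℝ => a * t) a t := by
    simpa using (hasDerivAt_id t).const_mul a
  have hp' := norm_ne_zero_iff.2 hp
  refine (((h1.cos.const_mul (‖p‖ / a)).smul_const _).add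
    ((h1.sin.const_mul (‖p‖ / a)).smul_const _)).congr_deriv ?_
  -- The minus sign in `rotationFrame` cancels the one from differentiating the cosine.
  simp only [rotationFrame, planeRotation]
  norm_num
  match_scalars <;> field_simp

end HelixODE

/-! ### Assembling the helix and the isometry -/

/-- The coordinates of `ℝ²ᵐ⁺¹ = (ℝ²)ᵐ × ℝ`. -/
def helixIndexEquiv (m : ℕ) : (Fin m × Fin 2) ⊕ Unit ≃ Fin (2 * m + 1) :=
  (Equiv.sumCongr (finProdFinEquiv.trans (finCongr (mul_comm m 2)))
    (Equiv.ofUnique Unit (Fin 1))).trans finSumFinEquiv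

theorem generalizedHelix_helixIndexEquiv_inl_zero {m : ℕ} (a r : Fin m → ℝ) (b t : ℝ)
    (i : Fin m) : generalizedHelix a r b t (helixIndexEquiv m (Sum.inl (i, 0))) =
      r i * Real.cos (a i * t) := by
  simp [generalizedHelix, helixIndexEquiv]

theorem generalizedHelix_helixIndexEquiv_inl_one {m : ℕ} (a r : Fin m → ℝ) (b t : ℝ)
    (i : Fin m) : generalizedHelix a r b t (helixIndexEquiv m (Sum.inl (i, 1))) =
      r i * Real.sin (a i * t) := by
  have h : (1 + 2 * (i : ℕ)) / 2 = i := by omega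
  simp [generalizedHelix, helixIndexEquiv, h]

theorem generalizedHelix_helixIndexEquiv_inr {m : ℕ} (a r : Fin m → ℝ) (b t : ℝ) :
    generalizedHelix a r b t (helixIndexEquiv m (Sum.inr ())) = b * t := by
  simp [generalizedHelix, helixIndexEquiv]

theorem exists_isometryEquiv_generalizedHelix {E : Type*} [NormedAddCommGroup E]
    [InnerProductSpace ℝ E] [FiniteDimensional ℝ E] {m : ℕ}
    (hm : Module.finrank ℝ E = 2 * m + 1) {A : E →ₗ[ℝ] E}
    (hA : ∀ x y, inner ℝ (A x) y = -inner ℝ x (A y)) {f g : ℝ → E} {I : Set ℝ}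
    (hI : Convex ℝ I) (hI' : UniqueDiffOn ℝ I)
    (hf : ∀ t ∈ I, HasDerivWithinAt f (g t) I t)
    (hg : ∀ t ∈ I, HasDerivWithinAt g (A (g t)) I t) {t₀ : ℝ} (ht₀ : t₀ ∈ I)
    (hcyc : ∀ S : Submodule ℝ E, (∀ x ∈ S, A x ∈ S) → g t₀ ∈ S → S = ⊤) :
    ∃ (a r : Fin m → ℝ) (b : ℝ),
      (∀ j, 0 < a j) ∧ Function.Injective a ∧ (∀ j, 0 < r j) ∧ b ≠ 0 ∧
      ∃ F : EuclideanSpace ℝ (Fin (2 * m + 1)) ≃ᵢ E,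
        ∀ t ∈ I, f t = F (generalizedHelix a r b t) := by
  obtain ⟨a, q, p₀, ha, hinj, hq, hAq, hp₀, hAp₀, he⟩ := exists_rotation_decomposition hA hm hcyc
  -- The components at time `t₀` are rotated back to time 0, so that the helix has no phase shifts.
  let p (i : Fin m) : E := planeRotation A (a i) (q i) (-t₀)
  have hpq (i : Fin m) : planeRotation A (a i) (p i) t₀ = q i :=
    planeRotation_neg_self (ha i).ne' (hAq i) t₀
  have hp (i : Fin m) : p i ≠ 0 := fun h => hq i (by rw [← hpq, h]; simp [planeRotation])
  have hAp (i : Fin m) : A (A (p i)) = -(a i ^ 2) • p i := apply_apply_planeRotation (hAq i) _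
  have hgsol : Set.EqOn g (fun t => ∑ i, planeRotation A (a i) (p i) t + p₀) I := by
    refine eqOn_of_skew_ode hA hI hI' hg (fun t _ => ?_) ht₀ ?_
    · rw [map_add, hAp₀, map_sum, add_zero]
      exact ((HasDerivAt.fun_sum fun i _ =>
        hasDerivAt_planeRotation (ha i).ne' (hAp i) t).add_const p₀).hasDerivWithinAt
    · simp only [hpq, he]
  -- This constant difference is the translation part of `F`; the orthonormal basis `B` gives the
  -- linear part.
  have hfsol (t : ℝ) (ht : t ∈ I) : f t - (∑ i, planeCircle A (a i) (p i) t + t • p₀) =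
      f t₀ - (∑ i, planeCircle A (a i) (p i) t₀ + t₀ • p₀) := by
    refine eq_of_hasDerivWithinAt_eq_zero
      (g := fun t => f t - (∑ i, planeCircle A (a i) (p i) t + t • p₀)) hI hI'
      (fun s hs => ?_) ht ht₀
    have h := (HasDerivAt.fun_sum fun i (_ : i ∈ Finset.univ) =>
      hasDerivAt_planeCircle (A := A) (ha i).ne' (hp i) s).fun_add
        ((hasDerivAt_id' s).smul_const p₀)
    refine ((hf s hs).fun_sub h.hasDerivWithinAt).congr_deriv ?_
    rw [hgsol hs, one_smul, sub_self]
  have ho := orthonormal_rotationFrame_sum hA ha hinj hp hAp hp₀ hAp₀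
  have hcard : Fintype.card ((Fin m × Fin 2) ⊕ Unit) = Module.finrank ℝ E := by
    rw [hm]; simp [mul_comm]
  let B := ((basisOfOrthonormalOfCardEqFinrank ho hcard).toOrthonormalBasis
    (by simpa using ho)).reindex (helixIndexEquiv m)
  have hB (x) : B (helixIndexEquiv m x) =
      Sum.elim (rotationFrame A a p) (fun _ : Unit => ‖p₀‖⁻¹ • p₀) x := by simp [B]
  refine ⟨a, fun i => ‖p i‖ / a i, ‖p₀‖, ha, hinj,
    fun i => div_pos (norm_pos_iff.2 (hp i)) (ha i), norm_ne_zero_iff.2 hp₀,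
    B.repr.symm.toIsometryEquiv.trans (IsometryEquiv.addRight
      (f t₀ - (∑ i, planeCircle A (a i) (p i) t₀ + t₀ • p₀))), fun t ht => ?_⟩
  rw [IsometryEquiv.trans_apply, IsometryEquiv.addRight_apply, ← hfsol t ht,
    LinearIsometryEquiv.coe_toIsometryEquiv, ← B.sum_repr_symm, ← (helixIndexEquiv m).sum_comp]
  simp only [hB, Fintype.sum_sum_type, Fintype.sum_prod_type, Fin.sum_univ_two, Sum.elim_inl,
    Sum.elim_inr, generalizedHelix_helixIndexEquiv_inl_zero,
    generalizedHelix_helixIndexEquiv_inl_one]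
  have h1 : (∑ _u : Unit, generalizedHelix a (fun i => ‖p i‖ / a i) ‖p₀‖ t
      (helixIndexEquiv m (Sum.inr _u)) • ‖p₀‖⁻¹ • p₀) = t • p₀ := by
    have := norm_ne_zero_iff.2 hp₀
    rw [Fintype.sum_unique, smul_smul]
    congr 1
    refine (congrArg (· * ‖p₀‖⁻¹) (generalizedHelix_helixIndexEquiv_inr _ _ _ _)).trans ?_
    field_simp
  rw [h1]
  exact (add_sub_cancel _ _).symm

theorem mainTheorem5 (m : ℕ) (hm : 0 < m)
    (ν : ℝ) (hν : 0 < ν) (κ : Fin (2 * m) → ℝ)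
    (hκpos : ∀ j : Fin (2 * m), (j : ℕ) + 1 < 2 * m → 0 < κ j)
    (hκlast : ∀ j : Fin (2 * m), (j : ℕ) + 1 = 2 * m → κ j ≠ 0)
    (I : Set ℝ) (hI : I.OrdConnected) (hI' : I.Nontrivial)
    (f : ℝ → EuclideanSpace ℝ (Fin (2 * m + 1)))
    (hf : ContDiffOn ℝ (2 * m + 1 : ℕ) f I)
    (hreg : IsRegularCurve (2 * m) f I)
    (hspeed : ∀ t ∈ I, curveSpeed f I t = ν)
    (hcurv : ∀ j : Fin (2 * m), ∀ t ∈ I, frenetCurvature f I j t = κ j) :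
    ∃ (a r : Fin m → ℝ) (b : ℝ),
      (∀ j, 0 < a j) ∧ Function.Injective a ∧ (∀ j, 0 < r j) ∧ b ≠ 0 ∧
      ∃ F : EuclideanSpace ℝ (Fin (2 * m + 1)) ≃ᵢ EuclideanSpace ℝ (Fin (2 * m + 1)),
        ∀ t ∈ I, f t = F (generalizedHelix a r b t) := by
  have hconv : Convex ℝ I := hI.convex
  have hu : UniqueDiffOn ℝ I :=
    uniqueDiffOn_convex hconv (hconv.nontrivial_iff_nonempty_interior.1 hI')
  obtain ⟨t₀, ht₀⟩ := hI'.nonempty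
  obtain ⟨ω, hω, hωsucc, hωfar, hV⟩ :=
    exists_frenet_equations hu ⟨t₀, ht₀⟩ hf hreg hν.ne' hspeed hcurv
  obtain ⟨A, hA, hAV⟩ := exists_skew_operator hconv hu ht₀ hω
    (fun t ht => orthonormal_frenetFrame hreg ht) hV
  -- Index 0 belongs to the Gram–Schmidt part of the frame because `0 < m`; there the vector is just
  -- `f'` normalized.
  have hV0 (t : ℝ) (ht : t ∈ I) : derivWithin f I t = ν • frenetFrame f I t 0 := by
    have h0 : (0 : Fin (2 * m + 1)) = (⟨0, by omega⟩ : Fin (2 * m)).castSucc := rfl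
    have hgs : InnerProductSpace.gramSchmidt ℝ
        (fun j : Fin (2 * m) => iteratedDerivWithin (j + 1) f I t) ⟨0, by omega⟩ =
        derivWithin f I t := by
      rw [InnerProductSpace.gramSchmidt_def, Finset.sum_eq_zero, sub_zero]
      · simp [iteratedDerivWithin_one]
      · intro i hi
        exact absurd (Finset.mem_Iio.1 hi) (Nat.not_lt_zero _)
    rw [h0, frenetFrame_castSucc, InnerProductSpace.gramSchmidtNormed, hgs, smul_smul,
      ← hspeed t ht]
    have : ‖derivWithin f I t‖ ≠ 0 := by
      rw [← curveSpeed, hspeed t ht]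
      exact hν.ne'
    simp [curveSpeed, this]
  have hκ (j : Fin (2 * m)) : κ j ≠ 0 := by
    obtain h | h := Nat.lt_or_eq_of_le (Nat.succ_le_of_lt j.2)
    · exact (hκpos j h).ne'
    · exact hκlast j h
  refine exists_isometryEquiv_generalizedHelix (by simp) hA
    (g := fun t => ν • frenetFrame f I t 0) hconv hu (fun t ht => ?_) (fun t ht => ?_) ht₀
    fun S hS h0 => ?_
  · rw [← hV0 t ht]
    exact (hf.differentiableOn (by simp) t ht).hasDerivWithinAt
  · rw [map_smul, hAV t ht]
    exact (hV t ht 0).const_smul ν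
  -- An invariant subspace containing `ν V₁` contains the whole frame, which spans.
  · have hmem := mem_of_tridiagonal (v := frenetFrame f I t₀)
      (fun j => by rw [hωsucc]; exact mul_ne_zero (hκ j) hν.ne') hωfar (hAV t₀ ht₀) hS
      ((S.smul_mem_iff hν.ne').1 h0)
    have hspan := (orthonormal_frenetFrame hreg ht₀).linearIndependent.span_eq_top_of_card_eq_finrank
      (by simp)
    rw [eq_top_iff, ← hspan, Submodule.span_le]
    rintro _ ⟨j, rfl⟩
    exact hmem j
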